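/- Let $H$ be a separable complex Hilbert space and let $\alpha$ be a $*$-automorphism of $B(H)$. Then there is a unitary $U\in B(H)$ with $\alpha(x)=UxU^*$ for all $x\in B(H)$. For every such $U$ and every Følner sequence $(F_n)$ of finite subsets of $\mathbb Z$, let $P_c$ be the orthogonal projection onto the compact part $H_c$ of $U$, i.e. the closed linear span of the eigenvectors of $U$, and let $P_{wm}$ be the orthogonal projection onto the weakly mixing part $$H_{wm}=\Big\{\xi\in H:\ \lim_{n\to\infty}\frac1{|F_n|}\sum_{k\in F_n}|\langle U^k\xi,\eta\rangle|^2=0\ \text{ for all }\eta\in H\Big\},$$ which is a closed subspace. Then $P_c+P_{wm}=1$ and: 1. if $P_c\neq 0$, there is a normal state $\varphi_c$ on $B(H)$ with $\varphi_c\circ\alpha=\varphi_c$ and support $s(\varphi_c)=P_c$; 2. there is a weakly wandering operator $x_{wm}\in B(H)$ with support $s(x_{wm})=P_{wm}$, that is, $x_{wm}\ge 0$ and $$\lim_{n\to\infty}\Big\|\frac1{|F_n|}\sum_{k\in F_n}\alpha^k(x_{wm})\Big\|=0 .$$ Here the support of a normal state $\varphi$ is $1-q$, where $q$ is the least upper bound,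 among projections, of the projections $e$ with $\varphi(e)=0$, and the support of a positive operator $x$ is the least projection $p$ with $px=x$. -/

import Mathlib

noncomputable section

namespace NeveuBH

open Filter Topology MeasureTheory
open scoped InnerProductSpace ComplexOrder

/-! ### Normal states on `B(H)` and supports -/

section States

variable {H : Type*} [NormedAddCommGroup H] [InnerProductSpace ℂ H] [CompleteSpace H]

/-- The ultraweak (`σ`-weak, or `w`-) topology on `B(H)`: the coarsest topology that makes all
functionals `x ↦ ∑ₙ ⟪ηₙ, x ξₙ⟫` with `∑ ‖ξₙ‖² < ∞` and `∑ ‖ηₙ‖² < ∞` continuous. -/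
@[reducible] def ultraweakTopology (H : Type*) [NormedAddCommGroup H] [InnerProductSpace ℂ H] :
    TopologicalSpace (H →L[ℂ] H) :=
  ⨅ (ξ : ℕ → H) (η : ℕ → H) (_ : Summable fun n ↦ ‖ξ n‖ ^ 2) (_ : Summable fun n ↦ ‖η n‖ ^ 2),
    TopologicalSpace.induced (fun x : H →L[ℂ] H ↦ ∑' n, ⟪η n, x (ξ n)⟫_ℂ) inferInstance

/-- A normal state on `B(H)`: a positive, unital and ultraweakly continuous linear functional. -/
structure IsNormalState (φ : (H →L[ℂ] H) →ₗ[ℂ] ℂ) : Prop where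
  nonneg : ∀ x : H →L[ℂ] H, 0 ≤ φ (star x * x)
  map_one : φ 1 = 1
  normal : @Continuous _ _ (ultraweakTopology H) inferInstance φ

/-- `p` is the support of the functional `φ`: it is `1 - q`, where `q` is the least upper bound,
among projections, of all projections on which `φ` vanishes. -/
def IsFunctionalSupport (φ : (H →L[ℂ] H) →ₗ[ℂ] ℂ) (p : H →L[ℂ] H) : Prop :=
  ∃ q : {e : H →L[ℂ] H // IsStarProjection e},
    IsLUB {e : {e : H →L[ℂ] H // IsStarProjection e} | φ (e : H →L[ℂ] H) = 0} q ∧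
      p = 1 - (q : H →L[ℂ] H)

/-- `p` is the support of the operator `x`: the least projection with `p x = x`. -/
def IsOperatorSupport (x p : H →L[ℂ] H) : Prop :=
  IsLeast {e : H →L[ℂ] H | IsStarProjection e ∧ e * x = x} p

/-- The average `Aₙ(x) = |Fₙ|⁻¹ ∑_{k ∈ Fₙ} αᵏ(x)`. -/
def average (α : (H →L[ℂ] H) ≃⋆ₐ[ℂ] (H →L[ℂ] H)) (F : ℕ → Finset ℤ) (n : ℕ)
    (x : H →L[ℂ] H) : H →L[ℂ] H :=
  ((F n).card : ℂ)⁻¹ • ∑ k ∈ F n, (α ^ k) x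

/-- A weakly wandering operator: a positive operator whose averages tend to `0` in norm. -/
def IsWeaklyWandering (α : (H →L[ℂ] H) ≃⋆ₐ[ℂ] (H →L[ℂ] H)) (F : ℕ → Finset ℤ)
    (x : H →L[ℂ] H) : Prop :=
  x.IsPositive ∧ Tendsto (fun n ↦ ‖average α F n x‖) atTop (𝓝 0)

/-- A Følner sequence of finite subsets of `ℤ` (with respect to counting measure). -/
def IsFolnerSeq (F : ℕ → Finset ℤ) : Prop :=
  IsAddFoelner ℤ (Measure.count : Measure ℤ) atTop (fun n ↦ (F n : Set ℤ))

end States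

/-! ### The compact and the weakly mixing part of a unitary -/

section Parts

variable {H : Type*} [NormedAddCommGroup H] [InnerProductSpace ℂ H] [CompleteSpace H]

/-- The compact part of `U`: the closed linear span of the eigenvectors of `U`. -/
def compactPart (U : unitary (H →L[ℂ] H)) : Submodule ℂ H :=
  (⨆ μ : ℂ, Module.End.eigenspace ((U : H →L[ℂ] H) : H →ₗ[ℂ] H) μ).topologicalClosure

instance compactPart_complete (U : unitary (H →L[ℂ] H)) : CompleteSpace (compactPart U) :=
  (Submodule.isClosed_topologicalClosure _).completeSpace_coe

/-- The averages `|Fₙ|⁻¹ ∑_{k ∈ Fₙ} |⟪Uᵏ ξ, η⟫|²`. -/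
def correlation (U : unitary (H →L[ℂ] H)) (F : ℕ → Finset ℤ) (ξ η : H) (n : ℕ) : ℝ :=
  ((F n).card : ℝ)⁻¹ * ∑ k ∈ F n, ‖⟪((U ^ k : unitary (H →L[ℂ] H)) : H →L[ℂ] H) ξ, η⟫_ℂ‖ ^ 2

theorem correlation_nonneg (U : unitary (H →L[ℂ] H)) (F : ℕ → Finset ℤ) (ξ η : H) (n : ℕ) :
    0 ≤ correlation U F ξ η n := by
  unfold correlation; positivity

theorem correlation_add_le (U : unitary (H →L[ℂ] H)) (F : ℕ → Finset ℤ) (ξ ζ η : H) (n : ℕ) :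
    correlation U F (ξ + ζ) η n ≤ 2 * correlation U F ξ η n + 2 * correlation U F ζ η n := by
  unfold correlation
  have h : ∑ k ∈ F n, ‖⟪((U ^ k : unitary (H →L[ℂ] H)) : H →L[ℂ] H) (ξ + ζ), η⟫_ℂ‖ ^ 2 ≤
      2 * ∑ k ∈ F n, ‖⟪((U ^ k : unitary (H →L[ℂ] H)) : H →L[ℂ] H) ξ, η⟫_ℂ‖ ^ 2 +
      2 * ∑ k ∈ F n, ‖⟪((U ^ k : unitary (H →L[ℂ] H)) : H →L[ℂ] H) ζ, η⟫_ℂ‖ ^ 2 := by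
    rw [Finset.mul_sum, Finset.mul_sum, ← Finset.sum_add_distrib]
    refine Finset.sum_le_sum fun k _ ↦ ?_
    rw [map_add, inner_add_left]
    set a := ⟪((U ^ k : unitary (H →L[ℂ] H)) : H →L[ℂ] H) ξ, η⟫_ℂ
    set b := ⟪((U ^ k : unitary (H →L[ℂ] H)) : H →L[ℂ] H) ζ, η⟫_ℂ
    have h1 := norm_add_le a b
    nlinarith [norm_nonneg (a + b), norm_nonneg a, norm_nonneg b, sq_nonneg (‖a‖ - ‖b‖)]
  have hc : (0 : ℝ) ≤ ((F n).card : ℝ)⁻¹ := by positivity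
  nlinarith [mul_le_mul_of_nonneg_left h hc]

theorem correlation_le (U : unitary (H →L[ℂ] H)) (F : ℕ → Finset ℤ) (ξ η : H) (n : ℕ) :
    correlation U F ξ η n ≤ (‖ξ‖ * ‖η‖) ^ 2 := by
  unfold correlation
  have h : ∑ k ∈ F n, ‖⟪((U ^ k : unitary (H →L[ℂ] H)) : H →L[ℂ] H) ξ, η⟫_ℂ‖ ^ 2 ≤
      ((F n).card : ℝ) * (‖ξ‖ * ‖η‖) ^ 2 := by
    rw [← nsmul_eq_mul]
    refine Finset.sum_le_card_nsmul _ _ _ fun k _ ↦ ?_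
    have h1 := norm_inner_le_norm (𝕜 := ℂ) (((U ^ k : unitary (H →L[ℂ] H)) : H →L[ℂ] H) ξ) η
    have h2 : ‖((U ^ k : unitary (H →L[ℂ] H)) : H →L[ℂ] H) ξ‖ = ‖ξ‖ :=
      (Unitary.linearIsometryEquiv (U ^ k)).norm_map ξ
    rw [h2] at h1
    gcongr
  rcases (F n).card.eq_zero_or_pos with h0 | h0
  · rw [h0]; simp; positivity
  · have h0' : (0 : ℝ) < (F n).card := by exact_mod_cast h0
    rw [inv_mul_le_iff₀ h0']
    exact h

/-- The weakly mixing part of `U`, with averages along `F`: all vectors `ξ` such that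
`|Fₙ|⁻¹ ∑_{k ∈ Fₙ} |⟪Uᵏ ξ, η⟫|² → 0` for every `η`. -/
def weaklyMixingPart (U : unitary (H →L[ℂ] H)) (F : ℕ → Finset ℤ) : Submodule ℂ H where
  carrier := {ξ | ∀ η : H, Tendsto (correlation U F ξ η) atTop (𝓝 0)}
  zero_mem' η := by
    have : correlation U F 0 η = fun _ ↦ 0 := by funext n; simp [correlation]
    rw [this]; exact tendsto_const_nhds
  add_mem' {ξ ζ} hξ hζ η := by
    refine squeeze_zero (correlation_nonneg U F _ η) (correlation_add_le U F ξ ζ η) ?_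
    simpa using ((hξ η).const_mul 2).add ((hζ η).const_mul 2)
  smul_mem' c ξ hξ η := by
    have : correlation U F (c • ξ) η = fun n ↦ ‖c‖ ^ 2 * correlation U F ξ η n := by
      funext n
      simp only [correlation, map_smul, inner_smul_left, norm_mul, RCLike.norm_conj, mul_pow]
      rw [← Finset.mul_sum]; ring
    rw [this]
    simpa using (hξ η).const_mul (‖c‖ ^ 2)

theorem isClosed_weaklyMixingPart (U : unitary (H →L[ℂ] H)) (F : ℕ → Finset ℤ) :
    IsClosed (weaklyMixingPart U F : Set H) := by
  refine isClosed_of_closure_subset fun ξ hξ η ↦ ?_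
  rw [Metric.tendsto_atTop]
  intro ε hε
  obtain ⟨δ, hδ, hδε⟩ : ∃ δ : ℝ, 0 < δ ∧ 2 * (δ * ‖η‖) ^ 2 < ε / 2 := by
    have hc : Tendsto (fun δ : ℝ ↦ 2 * (δ * ‖η‖) ^ 2) (𝓝[>] 0) (𝓝 0) := by
      have : Continuous fun δ : ℝ ↦ 2 * (δ * ‖η‖) ^ 2 := by fun_prop
      simpa using (this.tendsto 0).mono_left nhdsWithin_le_nhds
    obtain ⟨δ, h1, h2⟩ := ((hc.eventually_lt_const (half_pos hε)).and
      self_mem_nhdsWithin).exists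
    exact ⟨δ, h2, h1⟩
  obtain ⟨ζ, hζ, hd⟩ := Metric.mem_closure_iff.1 hξ δ hδ
  obtain ⟨N, hN⟩ := (Metric.tendsto_atTop.1 (hζ η)) (ε / 4) (by positivity)
  refine ⟨N, fun n hn ↦ ?_⟩
  have h1 := hN n hn
  rw [Real.dist_eq, sub_zero, abs_of_nonneg (correlation_nonneg U F _ _ _)] at h1 ⊢
  have h2 := correlation_add_le U F ζ (ξ - ζ) η n
  rw [add_sub_cancel] at h2
  have h3 := correlation_le U F (ξ - ζ) η n
  have h4 : (‖ξ - ζ‖ * ‖η‖) ^ 2 ≤ (δ * ‖η‖) ^ 2 := by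
    rw [dist_eq_norm] at hd
    gcongr
  linarith

instance weaklyMixingPart_complete (U : unitary (H →L[ℂ] H)) (F : ℕ → Finset ℤ) :
    CompleteSpace (weaklyMixingPart U F) :=
  (isClosed_weaklyMixingPart U F).completeSpace_coe

/-- `P_c`, the orthogonal projection onto the compact part. -/
def compactProj (U : unitary (H →L[ℂ] H)) : H →L[ℂ] H :=
  (compactPart U).starProjection

/-- `P_wm`, the orthogonal projection onto the weakly mixing part. -/
def weaklyMixingProj (U : unitary (H →L[ℂ] H)) (F : ℕ → Finset ℤ) : H →L[ℂ] H :=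
  (weaklyMixingPart U F).starProjection

end Parts

end NeveuBH

end

noncomputable section

namespace NeveuBH

open Filter Topology MeasureTheory
open scoped InnerProductSpace ComplexOrder

/-! ### Averages along a Følner sequence and the mean ergodic theorem -/

section Folner

open scoped Pointwise symmDiff

/-! The heart is that `ξ ⟂ H_c` forces the averages of `U^k ξ ⊗ (U^k ξ)^*` to tend to `0` in
operator norm. Conjugation by `U` is isometric for the Hilbert–Schmidt norm, modelled here by a real
tensor square, so the mean ergodic theorem makes these averages Cauchy, hence norm convergent to
some `T` (`cauchySeq_rankOneMean`). This `T` is compact and self-adjoint, commutes with `U` and has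
range in `H_cᗮ`. An eigenspace of `T` for a nonzero eigenvalue would be finite-dimensional and
`U`-invariant, so it would contain an eigenvector of `U` orthogonal to `H_c`; thus `T = 0`. The
correlations are the quadratic forms of these averages, so `H_cᗮ ≤ H_wm`; correlations with
eigenvectors do not decay, which gives equality. Both witnesses come from a weighted dense sequence
`f`: `x_wm = ∑ fₙ ⊗ fₙ^*` from the unit ball of `H_wm`, wandering by dominated convergence, and `φ_c
= ∑ ⟪fₙ, · fₙ⟫` from unit eigenvectors, whose vector states are invariant. Density determines the
supports. -/

theorem IsFolnerSeq.eventually_card_pos {F : ℕ → Finset ℤ} (hF : IsFolnerSeq F) :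
    ∀ᶠ n in atTop, 0 < (F n).card := by
  filter_upwards [hF.eventually_meas_ne_zero] with n hn
  rw [Finset.card_pos, Finset.nonempty_iff_ne_empty]
  rintro h
  simp [h] at hn

theorem IsFolnerSeq.tendsto_card_symmDiff {F : ℕ → Finset ℤ} (hF : IsFolnerSeq F) (j : ℤ) :
    Tendsto (fun n ↦ ((((j +ᵥ F n) ∆ F n).card : ℝ)) / (F n).card) atTop (𝓝 0) := by
  have h := (ENNReal.tendsto_toReal ENNReal.zero_ne_top).comp (hF.tendsto_meas_vadd_symmDiff j)
  refine h.congr fun n ↦ ?_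
  have h1 : (j +ᵥ (F n : Set ℤ)) ∆ (F n : Set ℤ) = (((j +ᵥ F n) ∆ F n : Finset ℤ) : Set ℤ) := by
    rw [Finset.coe_symmDiff, Finset.coe_vadd_finset]
  simp only [Function.comp_apply, h1, Measure.count_apply_finset, ENNReal.toReal_div,
    ENNReal.toReal_natCast]

/-- The mean of the values of `f` on a finite set of integers. -/
def finsetMean {E : Type*} [AddCommGroup E] [Module ℝ E] (F : Finset ℤ) (f : ℤ → E) : E :=
  (F.card : ℝ)⁻¹ • ∑ k ∈ F, f k

theorem norm_finsetMean_le {E : Type*} [SeminormedAddCommGroup E] [NormedSpace ℝ E] (F : Finset ℤ)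
    {f : ℤ → E} {C : ℝ} (hC : 0 ≤ C) (hf : ∀ k, ‖f k‖ ≤ C) : ‖finsetMean F f‖ ≤ C := by
  rw [finsetMean, norm_smul, norm_inv, Real.norm_natCast]
  have h : ‖∑ k ∈ F, f k‖ ≤ F.card * C := by
    simpa using norm_sum_le_of_le F (fun k _ ↦ hf k)
  rcases F.card.eq_zero_or_pos with h0 | h0
  · simpa [h0] using hC
  · rw [inv_mul_le_iff₀ (by exact_mod_cast h0)]
    exact h

/-- Common indices cancel; each index left in the symmetric difference contributes at most `C`. -/
theorem tendsto_finsetMean_shift {E : Type*} [SeminormedAddCommGroup E] [NormedSpace ℝ E]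
    {F : ℕ → Finset ℤ} (hF : IsFolnerSeq F) {f : ℤ → E} {C : ℝ} (hf : ∀ k, ‖f k‖ ≤ C) (j : ℤ) :
    Tendsto (fun n ↦ ‖finsetMean (F n) (fun k ↦ f (j + k)) - finsetMean (F n) f‖) atTop (𝓝 0) := by
  have h := (hF.tendsto_card_symmDiff j).const_mul C
  rw [mul_zero] at h
  refine squeeze_zero (fun _ ↦ norm_nonneg _) (fun n ↦ ?_) h
  have h1 : ∑ k ∈ F n, f (j + k) = ∑ k ∈ j +ᵥ F n, f k := by
    rw [Finset.vadd_finset_def, Finset.sum_image fun a _ b _ hab ↦ by simpa using hab]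
    simp
  rw [finsetMean, finsetMean, ← smul_sub, h1, ← Finset.sum_sdiff_sub_sum_sdiff, norm_smul, norm_inv,
    Real.norm_natCast, mul_div_assoc', div_eq_inv_mul]
  gcongr
  have h2 : ((j +ᵥ F n) ∆ F n).card = ((j +ᵥ F n) \ F n).card + (F n \ (j +ᵥ F n)).card := by
    rw [symmDiff_def, Finset.sup_eq_union, Finset.card_union_of_disjoint disjoint_sdiff_sdiff]
  have h3 (S : Finset ℤ) : ‖∑ k ∈ S, f k‖ ≤ S.card * C := by
    simpa using norm_sum_le_of_le S (fun k _ ↦ hf k)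
  rw [h2]
  push_cast
  have := norm_sub_le (∑ k ∈ (j +ᵥ F n) \ F n, f k) (∑ k ∈ F n \ (j +ᵥ F n), f k)
  linarith [h3 ((j +ᵥ F n) \ F n), h3 (F n \ (j +ᵥ F n))]

end Folner

/-- Mean ergodic theorem along a Følner sequence, in an inner product space that need not be
complete. -/
theorem cauchySeq_finsetMean {E : Type*} [NormedAddCommGroup E] [InnerProductSpace ℝ E]
    {F : ℕ → Finset ℤ} (hF : IsFolnerSeq F) (ρ : ℤ → E →ₗᵢ[ℝ] E)
    (hρ : ∀ j k v, ρ (j + k) v = ρ j (ρ k v)) (v : E) :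
    CauchySeq fun n ↦ finsetMean (F n) (fun k ↦ ρ k v) := by
  set a : ℕ → E := fun n ↦ finsetMean (F n) (fun k ↦ ρ k v) with ha
  set S : Set E := convexHull ℝ (Set.range fun k ↦ ρ k v) with hS
  have haS : ∀ᶠ n in atTop, a n ∈ S := by
    filter_upwards [hF.eventually_card_pos] with n hn
    simp only [ha, finsetMean, Finset.smul_sum]
    refine (convex_convexHull ℝ _).sum_mem (fun _ _ ↦ by positivity) ?_
      fun k _ ↦ subset_convexHull ℝ _ ⟨k, rfl⟩
    rw [Finset.sum_const, nsmul_eq_mul, mul_inv_cancel₀ (by positivity)]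
  have hlin (n : ℕ) (s t : ℝ) (x y : E) : finsetMean (F n) (fun k ↦ ρ k (s • x + t • y)) =
      s • finsetMean (F n) (fun k ↦ ρ k x) + t • finsetMean (F n) (fun k ↦ ρ k y) := by
    simp only [finsetMean, map_add, map_smul, Finset.sum_add_distrib, ← Finset.smul_sum, smul_add]
    rw [smul_comm s, smul_comm t]
  -- Replacing `v` by an orbit point shifts the index, which is asymptotically harmless; convex
  -- combinations inherit this.
  have hconv : ∀ w ∈ S, Tendsto (fun n ↦ ‖finsetMean (F n) (fun k ↦ ρ k w) - a n‖)
      atTop (𝓝 0) := by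
    intro w hw
    refine convexHull_min (t := {w | Tendsto
      (fun n ↦ ‖finsetMean (F n) (fun k ↦ ρ k w) - a n‖) atTop (𝓝 0)}) ?_ ?_ hw
    · rintro _ ⟨j, rfl⟩
      have := tendsto_finsetMean_shift hF (f := fun k ↦ ρ k v) (C := ‖v‖) (by simp) j
      refine this.congr fun n ↦ ?_
      simp only [ha, ← hρ, add_comm]
    · intro x hx y hy s t hs ht hst
      have h0 := (hx.const_mul s).add (hy.const_mul t)
      simp only [mul_zero, add_zero] at h0
      refine squeeze_zero (fun _ ↦ norm_nonneg _) (fun n ↦ ?_) h0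
      have h1 : s • finsetMean (F n) (fun k ↦ ρ k x) + t • finsetMean (F n) (fun k ↦ ρ k y) - a n =
          s • (finsetMean (F n) (fun k ↦ ρ k x) - a n) +
            t • (finsetMean (F n) (fun k ↦ ρ k y) - a n) := by
        have : a n = s • a n + t • a n := by rw [← add_smul, hst, one_smul]
        nth_rw 1 [this]
        module
      rw [hlin, h1]
      refine (norm_add_le _ _).trans ?_
      rw [norm_smul, norm_smul, Real.norm_of_nonneg hs, Real.norm_of_nonneg ht]
  have hSne : (norm '' S).Nonempty := ⟨_, _, subset_convexHull ℝ _ ⟨0, rfl⟩, rfl⟩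
  have hSbdd : BddBelow (norm '' S) := ⟨0, by rintro _ ⟨x, -, rfl⟩; exact norm_nonneg x⟩
  set d := sInf (norm '' S) with hd
  have hd0 : 0 ≤ d := le_csInf hSne (by rintro _ ⟨x, -, rfl⟩; exact norm_nonneg x)
  have hdle : ∀ w ∈ S, d ≤ ‖w‖ := fun w hw ↦ csInf_le hSbdd ⟨w, hw, rfl⟩
  -- Averaging does not increase the norm, so a near-minimizer `w` of the norm on `S` bounds `‖a n‖`
  -- asymptotically.
  have hup : ∀ δ > 0, ∀ᶠ n in atTop, ‖a n‖ < d + δ := by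
    intro δ hδ
    obtain ⟨_, ⟨w, hw, rfl⟩, hwd⟩ := exists_lt_of_csInf_lt hSne
      (show sInf (norm '' S) < d + δ / 2 by linarith)
    filter_upwards [(hconv w hw).eventually_lt_const (half_pos hδ)] with n hn
    have h1 : ‖finsetMean (F n) (fun k ↦ ρ k w)‖ ≤ ‖w‖ :=
      norm_finsetMean_le _ (norm_nonneg _) (by simp)
    have h2 := norm_sub_norm_le (a n) (finsetMean (F n) (fun k ↦ ρ k w))
    rw [norm_sub_rev] at h2
    linarith
  rw [Metric.cauchySeq_iff]
  intro ε hε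
  -- The midpoint of `a m` and `a n` lies in `S`, so `‖a m + a n‖ ≥ 2 * d`. The parallelogram law
  -- then bounds `‖a m - a n‖ ^ 2` by this difference.
  obtain ⟨δ, hδ, hδε⟩ : ∃ δ > 0, 4 * (d + δ) ^ 2 - 4 * d ^ 2 < ε ^ 2 := by
    have hc : Continuous fun δ : ℝ ↦ 4 * (d + δ) ^ 2 - 4 * d ^ 2 := by fun_prop
    have h0 := (hc.tendsto 0).mono_left (nhdsWithin_le_nhds (s := Set.Ioi 0))
    simp only [add_zero, sub_self] at h0
    obtain ⟨δ, h1, h2⟩ := ((h0.eventually_lt_const (show (0 : ℝ) < ε ^ 2 by positivity)).and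
      self_mem_nhdsWithin).exists
    exact ⟨δ, h2, h1⟩
  obtain ⟨N, hN⟩ := eventually_atTop.1 (haS.and (hup δ hδ))
  refine ⟨N, fun m hm n hn ↦ ?_⟩
  obtain ⟨hmS, hmd⟩ := hN m hm
  obtain ⟨hnS, hnd⟩ := hN n hn
  have hmid : (2 : ℝ)⁻¹ • a m + (2 : ℝ)⁻¹ • a n ∈ S :=
    convex_convexHull ℝ _ hmS hnS (by norm_num) (by norm_num) (by norm_num)
  have h1 := hdle _ hmid
  rw [← smul_add, norm_smul, norm_inv, Real.norm_two] at h1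
  have h2 := parallelogram_law_with_norm ℝ (a m) (a n)
  rw [dist_eq_norm]
  refine lt_of_pow_lt_pow_left₀ 2 hε.le ?_
  nlinarith [norm_nonneg (a m), norm_nonneg (a n)]

/-! ### Rank-one operators and the real tensor square -/

section HilbertSchmidt

open TensorProduct InnerProductSpace

attribute [local instance] InnerProductSpace.complexToReal

variable {H : Type*} [NormedAddCommGroup H] [InnerProductSpace ℂ H]

/-- The real-linear map on the (real) tensor square of `H` sending `a ⊗ b` to the rank-one operator
`η ↦ ⟪b, η⟫ a`. -/
def tensorToOperator (H : Type*) [NormedAddCommGroup H] [InnerProductSpace ℂ H] :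
    H ⊗[ℝ] H →ₗ[ℝ] (H →L[ℂ] H) :=
  TensorProduct.lift <| LinearMap.mk₂ ℝ (fun a b ↦ rankOne ℂ a b)
    (fun a a' b ↦ by simp)
    (fun c a b ↦ by ext η; exact smul_comm ⟪b, η⟫_ℂ c a)
    (fun a b b' ↦ by simp)
    (fun c a b ↦ by ext η; simp [mul_smul])

@[simp]
theorem tensorToOperator_tmul (a b : H) : tensorToOperator H (a ⊗ₜ[ℝ] b) = rankOne ℂ a b := rfl

/-- The first term yields the product of real parts; rotating both vectors by `I` yields the product
of imaginary parts. -/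
theorem re_inner_tensorToOperator (t : H ⊗[ℝ] H) (ζ η : H) :
    RCLike.re ⟪ζ, tensorToOperator H t η⟫_ℂ =
      ⟪ζ ⊗ₜ[ℝ] η, t⟫_ℝ + ⟪(Complex.I • ζ) ⊗ₜ[ℝ] (Complex.I • η), t⟫_ℝ := by
  induction t with
  | zero => simp
  | add x y hx hy =>
    simp only [map_add, _root_.add_apply, inner_add_right, hx, hy]
    ring
  | tmul a b =>
    simp only [tensorToOperator_tmul, rankOne_apply, inner_smul_right, TensorProduct.inner_tmul,
      real_inner_eq_re_inner ℂ, inner_smul_left]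
    have hre : (⟪η, b⟫_ℂ).re = (⟪b, η⟫_ℂ).re := inner_re_symm (𝕜 := ℂ) η b
    have him : (⟪η, b⟫_ℂ).im = -(⟪b, η⟫_ℂ).im := inner_im_symm (𝕜 := ℂ) η b
    simp [hre, him]
    ring

/-- Pairing the image of `η` with itself leaves two real inner products. Cauchy–Schwarz on each
accounts for the factor `2`. -/
theorem norm_tensorToOperator_le (t : H ⊗[ℝ] H) : ‖tensorToOperator H t‖ ≤ 2 * ‖t‖ := by
  refine ContinuousLinearMap.opNorm_le_bound _ (by positivity) fun η ↦ ?_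
  set ζ := tensorToOperator H t η with hζ
  have h := re_inner_tensorToOperator t ζ η
  rw [← hζ, inner_self_eq_norm_sq] at h
  have h1 := real_inner_le_norm (ζ ⊗ₜ[ℝ] η) t
  have h2 := real_inner_le_norm ((Complex.I • ζ) ⊗ₜ[ℝ] (Complex.I • η)) t
  simp only [TensorProduct.norm_tmul, norm_smul, Complex.norm_I, one_mul] at h1 h2
  by_contra! hlt
  nlinarith [norm_nonneg ζ, norm_nonneg η, norm_nonneg t,
    mul_nonneg (norm_nonneg t) (norm_nonneg η)]

end HilbertSchmidt

/-! ### The action of `U` on rank-one operators -/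

section Conjugation

open TensorProduct InnerProductSpace

attribute [local instance] InnerProductSpace.complexToReal

variable {H : Type*} [NormedAddCommGroup H] [InnerProductSpace ℂ H] [CompleteSpace H]

/-- The isometric action of `ℤ` on the real tensor square of `H` induced by a unitary. -/
def tensorAction (U : unitary (H →L[ℂ] H)) (k : ℤ) : H ⊗[ℝ] H →ₗᵢ[ℝ] H ⊗[ℝ] H :=
  let W : H →ₗᵢ[ℝ] H :=
    { toLinearMap := ((U ^ k : unitary (H →L[ℂ] H)) : H →L[ℂ] H).toLinearMap.restrictScalars ℝ
      norm_map' := fun v ↦ (Unitary.linearIsometryEquiv (U ^ k)).norm_map v }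
  TensorProduct.mapIsometry W W

theorem tensorAction_tmul (U : unitary (H →L[ℂ] H)) (k : ℤ) (a b : H) :
    tensorAction U k (a ⊗ₜ[ℝ] b) = (((U ^ k : unitary (H →L[ℂ] H)) : H →L[ℂ] H) a) ⊗ₜ[ℝ]
      (((U ^ k : unitary (H →L[ℂ] H)) : H →L[ℂ] H) b) := rfl

theorem tensorAction_add (U : unitary (H →L[ℂ] H)) (j k : ℤ) (t : H ⊗[ℝ] H) :
    tensorAction U (j + k) t = tensorAction U j (tensorAction U k t) := by
  induction t with
  | zero => simp
  | add x y hx hy => simp only [map_add, hx, hy]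
  | tmul a b => simp only [tensorAction_tmul, zpow_add]; rfl

/-- The mean along `F` of the rank-one operators `U^k ξ ⊗ (U^k ξ)^*`. -/
def rankOneMean (U : unitary (H →L[ℂ] H)) (F : Finset ℤ) (ξ : H) : H →L[ℂ] H :=
  finsetMean F fun k ↦ rankOne ℂ (((U ^ k : unitary (H →L[ℂ] H)) : H →L[ℂ] H) ξ)
    (((U ^ k : unitary (H →L[ℂ] H)) : H →L[ℂ] H) ξ)

/-- The uncompleted tensor product suffices: a bounded map preserves Cauchy sequences, and the limit
is taken later in `B(H)`. -/
theorem cauchySeq_rankOneMean {F : ℕ → Finset ℤ} (hF : IsFolnerSeq F) (U : unitary (H →L[ℂ] H))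
    (ξ : H) : CauchySeq fun n ↦ rankOneMean U (F n) ξ := by
  have h := cauchySeq_finsetMean hF (tensorAction U) (tensorAction_add U) (ξ ⊗ₜ[ℝ] ξ)
  have h1 (n : ℕ) : rankOneMean U (F n) ξ =
      tensorToOperator H (finsetMean (F n) fun k ↦ tensorAction U k (ξ ⊗ₜ[ℝ] ξ)) := by
    simp [rankOneMean, finsetMean, tensorAction_tmul]
  simp only [h1]
  exact (AddMonoidHomClass.uniformContinuous_of_bound (tensorToOperator H) 2
    norm_tensorToOperator_le).comp_cauchySeq h

theorem norm_unitary_zpow_apply (U : unitary (H →L[ℂ] H)) (k : ℤ) (ξ : H) :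
    ‖((U ^ k : unitary (H →L[ℂ] H)) : H →L[ℂ] H) ξ‖ = ‖ξ‖ :=
  (Unitary.linearIsometryEquiv (U ^ k)).norm_map ξ

/-- Conjugating by `U` shifts the summation index by `1`. -/
theorem tendsto_unitary_conj_rankOneMean {F : ℕ → Finset ℤ} (hF : IsFolnerSeq F)
    (U : unitary (H →L[ℂ] H)) (ξ : H) :
    Tendsto (fun n ↦ (U : H →L[ℂ] H) * rankOneMean U (F n) ξ * star (U : H →L[ℂ] H) -
      rankOneMean U (F n) ξ) atTop (𝓝 0) := by
  rw [tendsto_zero_iff_norm_tendsto_zero]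
  refine (tendsto_finsetMean_shift hF (C := ‖ξ‖ * ‖ξ‖) (f := fun k ↦
    rankOne ℂ (((U ^ k : unitary (H →L[ℂ] H)) : H →L[ℂ] H) ξ)
    (((U ^ k : unitary (H →L[ℂ] H)) : H →L[ℂ] H) ξ))
    (fun k ↦ by simp [norm_unitary_zpow_apply]) 1).congr fun n ↦ ?_
  congr 2
  simp only [rankOneMean, finsetMean, mul_smul_comm, smul_mul_assoc, Finset.mul_sum, Finset.sum_mul]
  congr 1
  refine Finset.sum_congr rfl fun k _ ↦ ?_
  ext η
  simp [zpow_add, ContinuousLinearMap.star_eq_adjoint, ContinuousLinearMap.adjoint_inner_right]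

end Conjugation

/-! ### The weakly mixing part is the orthogonal complement of the compact part -/

section Decomposition

open InnerProductSpace

variable {H : Type*} [NormedAddCommGroup H] [InnerProductSpace ℂ H] [CompleteSpace H]

theorem mem_compactPart_of_apply_eq_smul {U : unitary (H →L[ℂ] H)} {μ : ℂ} {v : H}
    (h : (U : H →L[ℂ] H) v = μ • v) : v ∈ compactPart U :=
  Submodule.le_topologicalClosure _ <|
    Submodule.mem_iSup_of_mem μ (Module.End.mem_eigenspace_iff.2 h)

theorem norm_eigenvalue_unitary {U : unitary (H →L[ℂ] H)} {μ : ℂ} {v : H} (hv : v ≠ 0)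
    (h : (U : H →L[ℂ] H) v = μ • v) : ‖μ‖ = 1 := by
  have h1 := Unitary.norm_map U v
  rw [h, norm_smul] at h1
  exact mul_eq_right₀ (norm_ne_zero_iff.2 hv) |>.1 h1

theorem inv_unitary_apply_eq_smul {U : unitary (H →L[ℂ] H)} {μ : ℂ} {v : H} (hv : v ≠ 0)
    (h : (U : H →L[ℂ] H) v = μ • v) : star (U : H →L[ℂ] H) v = μ⁻¹ • v := by
  have hμ : μ ≠ 0 := norm_ne_zero_iff.1 (by rw [norm_eigenvalue_unitary hv h]; exact one_ne_zero)
  have h1 : star (U : H →L[ℂ] H) ((U : H →L[ℂ] H) v) = v :=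
    congr($(Unitary.coe_star_mul_self U) v)
  rw [h, map_smul] at h1
  rw [← h1, smul_smul, inv_mul_cancel₀ hμ, one_smul, h1]

theorem unitary_zpow_apply_eq_smul {U : unitary (H →L[ℂ] H)} {μ : ℂ} {v : H} (hv : v ≠ 0)
    (h : (U : H →L[ℂ] H) v = μ • v) (k : ℤ) :
    ((U ^ k : unitary (H →L[ℂ] H)) : H →L[ℂ] H) v = μ ^ k • v := by
  have hμ : μ ≠ 0 := norm_ne_zero_iff.1 (by rw [norm_eigenvalue_unitary hv h]; exact one_ne_zero)
  induction k with
  | zero => simp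
  | succ n ih =>
    rw [zpow_add, zpow_one, zpow_add₀ hμ, zpow_one, Submonoid.coe_mul, mul_apply_eq_comp,
      h, map_smul, ih, smul_smul, mul_comm]
  | pred n ih =>
    rw [sub_eq_add_neg, zpow_add, zpow_neg_one, zpow_add₀ hμ, zpow_neg_one, Submonoid.coe_mul,
      mul_apply_eq_comp, ← Unitary.star_eq_inv, Unitary.coe_star,
      inv_unitary_apply_eq_smul hv h, map_smul, ih, smul_smul, mul_comm]

theorem unitary_zpow_inner_left (U : unitary (H →L[ℂ] H)) (k : ℤ) (x y : H) :
    ⟪((U ^ k : unitary (H →L[ℂ] H)) : H →L[ℂ] H) x, y⟫_ℂ =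
      ⟪x, ((U ^ (-k) : unitary (H →L[ℂ] H)) : H →L[ℂ] H) y⟫_ℂ := by
  rw [zpow_neg, ← Unitary.star_eq_inv, Unitary.coe_star, ContinuousLinearMap.star_eq_adjoint,
    ContinuousLinearMap.adjoint_inner_right]

theorem mem_orthogonal_compactPart_iff {U : unitary (H →L[ℂ] H)} {ξ : H} :
    ξ ∈ (compactPart U)ᗮ ↔ ∀ μ : ℂ, ∀ v : H, (U : H →L[ℂ] H) v = μ • v → ⟪v, ξ⟫_ℂ = 0 := by
  rw [compactPart, Submodule.orthogonal_closure, ← Submodule.iInf_orthogonal, Submodule.mem_iInf]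
  refine forall_congr' fun μ ↦ ?_
  rw [Submodule.mem_orthogonal]
  exact forall_congr' fun v ↦ imp_congr_left Module.End.mem_eigenspace_iff

theorem unitary_zpow_mem_orthogonal_compactPart {U : unitary (H →L[ℂ] H)} {ξ : H}
    (hξ : ξ ∈ (compactPart U)ᗮ) (k : ℤ) :
    ((U ^ k : unitary (H →L[ℂ] H)) : H →L[ℂ] H) ξ ∈ (compactPart U)ᗮ := by
  rw [mem_orthogonal_compactPart_iff] at hξ ⊢
  intro μ v hv
  rcases eq_or_ne v 0 with rfl | hv0
  · simp
  rw [← neg_neg k, ← unitary_zpow_inner_left, unitary_zpow_apply_eq_smul hv0 hv, inner_smul_left,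
    hξ μ v hv, mul_zero]

theorem isPositive_rankOneMean (U : unitary (H →L[ℂ] H)) (F : Finset ℤ) (ξ : H) :
    (rankOneMean U F ξ).IsPositive := by
  rw [rankOneMean, finsetMean, ← Complex.coe_smul]
  refine ContinuousLinearMap.IsPositive.smul_of_nonneg ?_ (by positivity)
  exact ContinuousLinearMap.isPositive_sum _ fun k _ ↦ isPositive_rankOne_self _

theorem isCompactOperator_rankOneMean (U : unitary (H →L[ℂ] H)) (F : Finset ℤ) (ξ : H) :
    IsCompactOperator (rankOneMean U F ξ) := by
  have h : rankOneMean U F ξ ∈ compactOperator (RingHom.id ℂ) H H := by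
    rw [rankOneMean, finsetMean, ← Complex.coe_smul]
    refine Submodule.smul_mem _ _ (Submodule.sum_mem _ fun k _ ↦ ?_)
    rw [rankOne_def']
    exact IsCompactOperator.clm_comp (isCompactOperator_of_locallyCompactSpace_dom (innerSL ℂ
      (((U ^ k : unitary (H →L[ℂ] H)) : H →L[ℂ] H) ξ)))
      (ContinuousLinearMap.toSpanSingleton ℂ (((U ^ k : unitary (H →L[ℂ] H)) : H →L[ℂ] H) ξ))
  exact h

theorem rankOneMean_apply_mem {U : unitary (H →L[ℂ] H)} {ξ : H} (hξ : ξ ∈ (compactPart U)ᗮ)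
    (F : Finset ℤ) (η : H) : rankOneMean U F ξ η ∈ (compactPart U)ᗮ := by
  rw [rankOneMean, finsetMean, ← Complex.coe_smul, _root_.smul_apply,
    _root_.sum_apply]
  exact Submodule.smul_mem _ _ (Submodule.sum_mem _ fun k _ ↦
    Submodule.smul_mem _ _ (unitary_zpow_mem_orthogonal_compactPart hξ k))

/-- A compact self-adjoint operator commuting with `U` whose range is orthogonal to all eigenvectors
of `U` vanishes. -/
theorem eq_zero_of_commute_of_range_le {U : unitary (H →L[ℂ] H)} {T : H →L[ℂ] H}
    (hT : IsCompactOperator T) (hT' : (T : H →ₗ[ℂ] H).IsSymmetric)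
    (hcomm : (U : H →L[ℂ] H) * T = T * U) (hrange : ∀ η, T η ∈ (compactPart U)ᗮ) : T = 0 := by
  rw [← ContinuousLinearMap.eq_zero_of_forall_hasEigenvalue_eq_zero hT hT']
  intro lam hlam
  by_contra hne
  set V := Module.End.eigenspace (T : H →ₗ[ℂ] H) lam with hV
  have : FiniteDimensional ℂ V :=
    ContinuousLinearMap.finite_dimensional_eigenspace hT lam hne
  have : Nontrivial V := (Submodule.nontrivial_iff_ne_bot).2 hlam
  have hinv : ∀ v ∈ V, ((U : H →L[ℂ] H) : H →ₗ[ℂ] H) v ∈ V := by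
    intro v hv
    rw [hV, Module.End.mem_eigenspace_iff] at hv ⊢
    have h1 : (U : H →L[ℂ] H) (T v) = T ((U : H →L[ℂ] H) v) := congr($hcomm v)
    simp only [ContinuousLinearMap.coe_coe] at hv ⊢
    rw [← h1, hv, map_smul]
  -- The resulting common eigenvector `v` lies in `compactPart U`, while `T v = lam • v` is
  -- orthogonal to it.
  obtain ⟨μ, hμ⟩ :=
    Module.End.exists_eigenvalue ((((U : H →L[ℂ] H) : H →ₗ[ℂ] H)).restrict hinv)
  obtain ⟨⟨v, hvV⟩, hv⟩ := hμ.exists_hasEigenvector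
  have hv0 : v ≠ 0 := fun h ↦ hv.2 (Subtype.ext h)
  have hUv : (U : H →L[ℂ] H) v = μ • v := congr_arg Subtype.val hv.apply_eq_smul
  have hTv : T v = lam • v := Module.End.mem_eigenspace_iff.1 hvV
  have h2 := mem_orthogonal_compactPart_iff.1 (hrange v) μ v hUv
  rw [hTv, inner_smul_right, mul_eq_zero, inner_self_eq_zero] at h2
  exact h2.elim hne hv0

/-- For `ξ` orthogonal to the compact part, the means of the rank-one operators along the orbit of
`ξ` tend to `0` in norm. -/
theorem tendsto_rankOneMean_zero {F : ℕ → Finset ℤ} (hF : IsFolnerSeq F)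
    {U : unitary (H →L[ℂ] H)} {ξ : H} (hξ : ξ ∈ (compactPart U)ᗮ) :
    Tendsto (fun n ↦ rankOneMean U (F n) ξ) atTop (𝓝 0) := by
  obtain ⟨T, hT⟩ := cauchySeq_tendsto_of_complete (cauchySeq_rankOneMean hF U ξ)
  have hconj : (U : H →L[ℂ] H) * T * star (U : H →L[ℂ] H) - T = 0 :=
    tendsto_nhds_unique (((hT.const_mul _).mul_const _).sub hT)
      (tendsto_unitary_conj_rankOneMean hF U ξ)
  have hcomm : (U : H →L[ℂ] H) * T = T * U := by
    rw [sub_eq_zero] at hconj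
    nth_rw 2 [← hconj]
    rw [mul_assoc _ _ (U : H →L[ℂ] H), Unitary.coe_star_mul_self, mul_one]
  have happ (η : H) : Tendsto (fun n ↦ rankOneMean U (F n) ξ η) atTop (𝓝 (T η)) :=
    ((ContinuousLinearMap.apply ℂ H η).continuous.tendsto T).comp hT
  have hsymm : (T : H →ₗ[ℂ] H).IsSymmetric := fun x y ↦
    tendsto_nhds_unique ((happ x).inner tendsto_const_nhds) <|
      (tendsto_const_nhds.inner (happ y)).congr fun n ↦
        ((isPositive_rankOneMean U (F n) ξ).isSymmetric x y).symm
  have hcpt : IsCompactOperator T := isCompactOperator_of_tendsto hT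
    (Eventually.of_forall fun n ↦ isCompactOperator_rankOneMean U (F n) ξ)
  have hrange (η : H) : T η ∈ (compactPart U)ᗮ :=
    (Submodule.isClosed_orthogonal _).mem_of_tendsto (happ η)
      (Eventually.of_forall fun n ↦ rankOneMean_apply_mem hξ (F n) η)
  rwa [eq_zero_of_commute_of_range_le hcpt hsymm hcomm hrange] at hT

/-- This turns operator-norm decay of the means into weak mixing. -/
theorem correlation_eq_re_inner (U : unitary (H →L[ℂ] H)) (F : ℕ → Finset ℤ) (ξ η : H) (n : ℕ) :
    correlation U F ξ η n = RCLike.re ⟪η, rankOneMean U (F n) ξ η⟫_ℂ := by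
  rw [rankOneMean, finsetMean, ← Complex.coe_smul]
  simp only [correlation, _root_.smul_apply, _root_.sum_apply,
    rankOne_apply, inner_smul_right, inner_sum]
  rw [RCLike.re_eq_complex_re, Complex.re_ofReal_mul, Complex.re_sum]
  congr 1
  refine Finset.sum_congr rfl fun k _ ↦ ?_
  rw [← inner_conj_symm η, Complex.mul_conj, Complex.normSq_eq_norm_sq, Complex.ofReal_re]

theorem weaklyMixingPart_eq_orthogonal {F : ℕ → Finset ℤ} (hF : IsFolnerSeq F)
    (U : unitary (H →L[ℂ] H)) : weaklyMixingPart U F = (compactPart U)ᗮ := by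
  refine le_antisymm (fun ξ hξ ↦ ?_) fun ξ hξ η ↦ ?_
  · rw [mem_orthogonal_compactPart_iff]
    intro μ v hv
    rcases eq_or_ne v 0 with rfl | hv0
    · simp
    -- Eigenvalues have modulus one, so all summands agree. Only eventually: for empty `F n` the
    -- correlation is `0` by convention.
    have h1 : ∀ᶠ n in atTop, correlation U F ξ v n = ‖⟪ξ, v⟫_ℂ‖ ^ 2 := by
      filter_upwards [hF.eventually_card_pos] with n hn
      rw [correlation, Finset.sum_congr rfl (g := fun _ ↦ ‖⟪ξ, v⟫_ℂ‖ ^ 2), Finset.sum_const,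
        nsmul_eq_mul, inv_mul_cancel_left₀ (by positivity)]
      intro k _
      rw [unitary_zpow_inner_left, unitary_zpow_apply_eq_smul hv0 hv, inner_smul_right, norm_mul,
        norm_zpow, norm_eigenvalue_unitary hv0 hv, one_zpow, one_mul]
    have h2 := tendsto_nhds_unique (tendsto_const_nhds.congr' (h1.mono fun _ h ↦ h.symm)) (hξ v)
    rw [sq_eq_zero_iff, norm_eq_zero] at h2
    exact inner_eq_zero_symm.1 h2
  · have h := (tendsto_rankOneMean_zero hF hξ).norm
    rw [norm_zero] at h
    have h' := (h.mul_const ‖η‖).const_mul ‖η‖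
    rw [zero_mul, mul_zero] at h'
    refine squeeze_zero (correlation_nonneg U F ξ η) (fun n ↦ ?_) h'
    rw [correlation_eq_re_inner]
    refine (RCLike.re_le_norm _).trans ((norm_inner_le_norm _ _).trans ?_)
    gcongr
    exact ContinuousLinearMap.le_opNorm _ _

theorem compactProj_add_weaklyMixingProj {F : ℕ → Finset ℤ} (hF : IsFolnerSeq F)
    (U : unitary (H →L[ℂ] H)) : compactProj U + weaklyMixingProj U F = 1 := by
  have h : weaklyMixingProj U F = (compactPart U)ᗮ.starProjection := by
    simp only [weaklyMixingProj, weaklyMixingPart_eq_orthogonal hF U]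
  rw [h, Submodule.starProjection_orthogonal', compactProj, add_sub_cancel]

end Decomposition

/-! ### States and positive operators from square-summable sequences, and their supports -/

section SquareSummable

open InnerProductSpace

variable {H : Type*} [NormedAddCommGroup H] [InnerProductSpace ℂ H]

theorem summable_inner_apply {f : ℕ → H} (hf : Summable fun n ↦ ‖f n‖ ^ 2) (x : H →L[ℂ] H) :
    Summable fun n ↦ ⟪f n, x (f n)⟫_ℂ := by
  refine Summable.of_norm_bounded (hf.mul_left ‖x‖) fun n ↦ ?_
  refine (norm_inner_le_norm _ _).trans ?_
  nlinarith [x.le_opNorm (f n), norm_nonneg (f n)]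

/-- The functional `x ↦ ∑ₙ ⟪fₙ, x fₙ⟫` of a square-summable sequence. -/
def vectorFunctional (f : ℕ → H) (hf : Summable fun n ↦ ‖f n‖ ^ 2) : (H →L[ℂ] H) →ₗ[ℂ] ℂ where
  toFun x := ∑' n, ⟪f n, x (f n)⟫_ℂ
  map_add' x y := by
    simp only [_root_.add_apply, inner_add_right]
    exact (summable_inner_apply hf x).tsum_add (summable_inner_apply hf y)
  map_smul' c x := by
    simp only [_root_.smul_apply, inner_smul_right, tsum_mul_left, smul_eq_mul, RingHom.id_apply]

theorem vectorFunctional_apply {f : ℕ → H} (hf : Summable fun n ↦ ‖f n‖ ^ 2) (x : H →L[ℂ] H) :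
    vectorFunctional f hf x = ∑' n, ⟪f n, x (f n)⟫_ℂ := rfl

theorem summable_norm_apply_sq {f : ℕ → H} (hf : Summable fun n ↦ ‖f n‖ ^ 2) (x : H →L[ℂ] H) :
    Summable fun n ↦ ‖x (f n)‖ ^ 2 := by
  refine Summable.of_nonneg_of_le (fun _ ↦ by positivity) (fun n ↦ ?_) (hf.mul_left (‖x‖ ^ 2))
  rw [← mul_pow]
  gcongr
  exact x.le_opNorm _

/-- A dense sequence in `E` is scaled by square roots of weights with sum one. Positive weights do
not change which operators annihilate it, and continuity extends vanishing to `E`. -/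
theorem exists_squareSummable_separating [TopologicalSpace.SeparableSpace H] {E : Set H}
    (hE : E.Nonempty) (hE1 : ∀ v ∈ E, ‖v‖ ≤ 1) :
    ∃ f : ℕ → H, (Summable fun n ↦ ‖f n‖ ^ 2) ∧
      ((∀ v ∈ E, ‖v‖ = 1) → HasSum (fun n ↦ ‖f n‖ ^ 2) 1) ∧
      (∀ n, ∃ c : ℂ, ∃ v ∈ E, f n = c • v) ∧
      ∀ x : H →L[ℂ] H, (∀ n, x (f n) = 0) → ∀ v ∈ E, x v = 0 := by
  have : SecondCountableTopology H := UniformSpace.secondCountable_of_separable H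
  have : Nonempty E := hE.to_subtype
  set e : ℕ → E := TopologicalSpace.denseSeq E with he
  set c : ℕ → ℝ := fun n ↦ 1 / 2 / 2 ^ n with hc
  have hc0 : ∀ n, 0 < c n := fun n ↦ by positivity
  have hc1 : HasSum c 1 := hasSum_geometric_two' 1
  have hf (n : ℕ) : ‖((√(c n) : ℝ) : ℂ) • (e n : H)‖ ^ 2 = c n * ‖(e n : H)‖ ^ 2 := by
    rw [norm_smul, Complex.norm_real, mul_pow, Real.norm_eq_abs, sq_abs, Real.sq_sqrt (hc0 n).le]
  refine ⟨fun n ↦ ((√(c n) : ℝ) : ℂ) • (e n : H), ?_, fun h ↦ ?_, fun n ↦ ⟨_, e n, (e n).2, rfl⟩,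
    fun x hx v hv ↦ ?_⟩
  · simp only [hf]
    refine Summable.of_nonneg_of_le (fun n ↦ by have := hc0 n; positivity) (fun n ↦ ?_) hc1.summable
    exact mul_le_of_le_one_right (hc0 n).le (pow_le_one₀ (norm_nonneg _) (hE1 _ (e n).2))
  · simp only [hf, h _ (e _).2, one_pow, mul_one]
    exact hc1
  · have hxe (n : ℕ) : x (e n) = 0 := by
      have := hx n
      rw [map_smul, smul_eq_zero] at this
      refine this.resolve_left ?_
      exact_mod_cast (Real.sqrt_pos.2 (hc0 n)).ne'
    have hcl : IsClosed {w : E | x w = 0} :=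
      isClosed_eq (x.continuous.comp continuous_subtype_val) continuous_const
    have hd : Dense {w : E | x w = 0} :=
      (TopologicalSpace.denseRange_denseSeq E).mono (by rintro _ ⟨n, rfl⟩; exact hxe n)
    have hu := hcl.closure_eq ▸ hd.closure_eq
    exact (hu.symm ▸ Set.mem_univ (⟨v, hv⟩ : E) : (⟨v, hv⟩ : E) ∈ {w : E | x w = 0})

variable [CompleteSpace H]

theorem vectorFunctional_star_mul_self {f : ℕ → H} (hf : Summable fun n ↦ ‖f n‖ ^ 2)
    (x : H →L[ℂ] H) : vectorFunctional f hf (star x * x) = ((∑' n, ‖x (f n)‖ ^ 2 : ℝ) : ℂ) := by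
  rw [vectorFunctional_apply, Complex.ofReal_tsum]
  refine tsum_congr fun n ↦ ?_
  rw [mul_apply_eq_comp, ContinuousLinearMap.star_eq_adjoint,
    ContinuousLinearMap.adjoint_inner_right, inner_self_eq_norm_sq_to_K]
  simp

theorem isNormalState_vectorFunctional {f : ℕ → H} (hf : HasSum (fun n ↦ ‖f n‖ ^ 2) 1) :
    IsNormalState (vectorFunctional f hf.summable) where
  nonneg x := by
    rw [vectorFunctional_star_mul_self]
    exact_mod_cast tsum_nonneg fun n ↦ by positivity
  map_one := by
    have h := vectorFunctional_star_mul_self hf.summable (1 : H →L[ℂ] H)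
    simpa [hf.tsum_eq] using h
  normal := by
    refine continuous_iff_le_induced.2 ?_
    exact (iInf_le _ f).trans ((iInf_le _ f).trans
      ((iInf_le _ hf.summable).trans (iInf_le _ hf.summable)))

theorem vectorFunctional_eq_zero_iff {f : ℕ → H} (hf : Summable fun n ↦ ‖f n‖ ^ 2)
    {e : H →L[ℂ] H} (he : IsStarProjection e) :
    vectorFunctional f hf e = 0 ↔ ∀ n, e (f n) = 0 := by
  have h1 : star e * e = e := by rw [he.isSelfAdjoint.star_eq, he.isIdempotentElem.eq]
  have h2 := vectorFunctional_star_mul_self hf e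
  rw [h1] at h2
  rw [h2, Complex.ofReal_eq_zero]
  constructor
  · intro h n
    have := (hasSum_zero_iff_of_nonneg (fun n ↦ sq_nonneg ‖e (f n)‖)).1
      (h ▸ (summable_norm_apply_sq hf e).hasSum)
    simpa using congr_fun this n
  · intro h
    simp [h]

/-- On a projection `e` the functional is `∑ ‖e (f n)‖ ^ 2`, so it vanishes exactly when `e` kills
`K`. The null projections thus have a greatest element. -/
theorem isFunctionalSupport_vectorFunctional {f : ℕ → H} (hf : Summable fun n ↦ ‖f n‖ ^ 2)
    (K : Submodule ℂ H) [K.HasOrthogonalProjection] (hfK : ∀ n, f n ∈ K)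
    (hK : ∀ x : H →L[ℂ] H, (∀ n, x (f n) = 0) → ∀ v ∈ K, x v = 0) :
    IsFunctionalSupport (vectorFunctional f hf) K.starProjection := by
  have hP : IsStarProjection (1 - K.starProjection) := isStarProjection_starProjection.one_sub
  refine ⟨⟨1 - K.starProjection, hP⟩, IsGreatest.isLUB ⟨?_, ?_⟩, (sub_sub_cancel _ _).symm⟩
  · rw [Set.mem_ofPred_eq, vectorFunctional_eq_zero_iff hf hP]
    intro n
    simp [K.starProjection_eq_self_iff.2 (hfK n)]
  · rintro ⟨e, he⟩ h
    rw [Set.mem_ofPred_eq, vectorFunctional_eq_zero_iff hf he] at h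
    change e ≤ 1 - K.starProjection
    rw [he.le_iff_mul_eq_left hP, mul_sub, mul_one, sub_eq_self]
    ext η
    exact hK e h _ (K.starProjection_apply_mem η)

/-- The positive trace-class operator `∑ₙ fₙ ⊗ fₙ^*` of a square-summable sequence. -/
def vectorOperator (f : ℕ → H) : H →L[ℂ] H := ∑' n, rankOne ℂ (f n) (f n)

theorem hasSum_vectorOperator {f : ℕ → H} (hf : Summable fun n ↦ ‖f n‖ ^ 2) :
    HasSum (fun n ↦ rankOne ℂ (f n) (f n)) (vectorOperator f) := by
  refine Summable.hasSum (Summable.of_norm ?_)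
  simpa only [norm_rankOne, sq] using hf

theorem hasSum_inner_vectorOperator {f : ℕ → H} (hf : Summable fun n ↦ ‖f n‖ ^ 2) (η : H) :
    HasSum (fun n ↦ ((‖⟪f n, η⟫_ℂ‖ ^ 2 : ℝ) : ℂ)) ⟪η, vectorOperator f η⟫_ℂ := by
  have h := ((hasSum_vectorOperator hf).mapL (ContinuousLinearMap.apply ℂ H η)).mapL (innerSL ℂ η)
  refine h.congr_fun fun n ↦ ?_
  simp only [ContinuousLinearMap.apply_apply, rankOne_apply, innerSL_apply_apply, inner_smul_right]
  rw [← inner_conj_symm η, Complex.mul_conj, Complex.normSq_eq_norm_sq]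

theorem isPositive_vectorOperator {f : ℕ → H} (hf : Summable fun n ↦ ‖f n‖ ^ 2) :
    (vectorOperator f).IsPositive := by
  rw [ContinuousLinearMap.isPositive_iff_complex]
  intro η
  have h : ⟪vectorOperator f η, η⟫_ℂ = ((∑' n, ‖⟪f n, η⟫_ℂ‖ ^ 2 : ℝ) : ℂ) := by
    rw [← inner_conj_symm, ← (hasSum_inner_vectorOperator hf η).tsum_eq, ← Complex.ofReal_tsum,
      Complex.conj_ofReal]
  rw [h]
  refine ⟨by simp, ?_⟩
  rw [RCLike.re_eq_complex_re, Complex.ofReal_re]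
  exact tsum_nonneg fun n ↦ by positivity

theorem inner_eq_zero_of_vectorOperator_apply_eq_zero {f : ℕ → H}
    (hf : Summable fun n ↦ ‖f n‖ ^ 2) {η : H} (h : vectorOperator f η = 0) (n : ℕ) :
    ⟪f n, η⟫_ℂ = 0 := by
  have h1 := hasSum_inner_vectorOperator hf η
  rw [h, inner_zero_right, ← Complex.ofReal_zero, Complex.hasSum_ofReal,
    hasSum_zero_iff_of_nonneg fun n ↦ sq_nonneg _] at h1
  simpa using congr_fun h1 n

theorem isOperatorSupport_vectorOperator {f : ℕ → H} (hf : Summable fun n ↦ ‖f n‖ ^ 2)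
    (K : Submodule ℂ H) [K.HasOrthogonalProjection] (hfK : ∀ n, f n ∈ K)
    (hK : ∀ x : H →L[ℂ] H, (∀ n, x (f n) = 0) → ∀ v ∈ K, x v = 0) :
    IsOperatorSupport (vectorOperator f) K.starProjection := by
  refine ⟨⟨isStarProjection_starProjection, ?_⟩, ?_⟩
  · refine ((hasSum_vectorOperator hf).mul_left K.starProjection).unique ?_
    refine (hasSum_vectorOperator hf).congr_fun fun n ↦ ?_
    ext η
    simp [K.starProjection_eq_self_iff.2 (hfK n)]
  · rintro e ⟨he, hex⟩
    -- Taking adjoints puts the range of `1 - e` in the kernel of the operator. Its quadratic form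
    -- `∑ |⟪f n, η⟫|²` then makes that range orthogonal to every `f n`.
    have hxe : vectorOperator f * e = vectorOperator f := by
      have := congr_arg star hex
      rwa [star_mul, he.isSelfAdjoint.star_eq,
        (isPositive_vectorOperator hf).isSelfAdjoint.star_eq] at this
    rw [isStarProjection_starProjection.le_iff_mul_eq_right he]
    have hz : ∀ n, (1 - e) (f n) = 0 := fun n ↦ by
      refine ext_inner_right ℂ fun ζ ↦ ?_
      have hsymm : ContinuousLinearMap.adjoint (1 - e) = 1 - e :=
        he.one_sub.isSelfAdjoint.star_eq
      rw [inner_zero_left, ← hsymm, ContinuousLinearMap.adjoint_inner_left]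
      refine inner_eq_zero_of_vectorOperator_apply_eq_zero hf ?_ n
      have : (vectorOperator f * (1 - e)) ζ = 0 := by
        rw [mul_sub, mul_one, hxe, sub_self, _root_.zero_apply]
      exact this
    ext η
    have h1 := hK _ hz _ (K.starProjection_apply_mem η)
    rw [_root_.sub_apply, sub_eq_zero] at h1
    exact h1.symm

end SquareSummable

/-! ### The implementing unitary, the weakly wandering operator and the invariant state -/

section Main

open InnerProductSpace

variable {H : Type*} [NormedAddCommGroup H] [InnerProductSpace ℂ H] [CompleteSpace H]

theorem exists_unitary_of_starAlgEquiv (α : (H →L[ℂ] H) ≃⋆ₐ[ℂ] (H →L[ℂ] H)) :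
    ∃ U : unitary (H →L[ℂ] H), ∀ x, α x = U * x * star (U : H →L[ℂ] H) := by
  obtain ⟨e, he⟩ := StarAlgEquiv.eq_linearIsometryEquivConjStarAlgEquiv α
    (StarAlgEquiv.isometry α).continuous
  refine ⟨Unitary.linearIsometryEquiv.symm e, fun x ↦ ?_⟩
  rw [he, ← Unitary.conjStarAlgAut_symm_unitaryLinearIsometryEquiv, Unitary.conjStarAlgAut_apply]

theorem starAlgEquiv_zpow_apply {α : (H →L[ℂ] H) ≃⋆ₐ[ℂ] (H →L[ℂ] H)} {U : unitary (H →L[ℂ] H)}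
    (hU : ∀ x, α x = U * x * star (U : H →L[ℂ] H)) (k : ℤ) (x : H →L[ℂ] H) :
    (α ^ k) x = (U ^ k : unitary (H →L[ℂ] H)) * x *
      star ((U ^ k : unitary (H →L[ℂ] H)) : H →L[ℂ] H) := by
  have h : α = Unitary.conjStarAlgAut ℂ _ U :=
    StarAlgEquiv.ext fun x ↦ by rw [hU, Unitary.conjStarAlgAut_apply]
  rw [h, ← map_zpow, Unitary.conjStarAlgAut_apply]

theorem average_rankOne {α : (H →L[ℂ] H) ≃⋆ₐ[ℂ] (H →L[ℂ] H)} {U : unitary (H →L[ℂ] H)}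
    (hU : ∀ x, α x = U * x * star (U : H →L[ℂ] H)) (F : ℕ → Finset ℤ) (n : ℕ) (ξ : H) :
    average α F n (rankOne ℂ ξ ξ) = rankOneMean U (F n) ξ := by
  rw [average, rankOneMean, finsetMean, ← Complex.coe_smul]
  push_cast
  congr 1
  refine Finset.sum_congr rfl fun k _ ↦ ?_
  rw [starAlgEquiv_zpow_apply hU]
  ext η
  simp [ContinuousLinearMap.star_eq_adjoint, ContinuousLinearMap.adjoint_inner_right]

theorem hasSum_average {α : (H →L[ℂ] H) ≃⋆ₐ[ℂ] (H →L[ℂ] H)} (F : ℕ → Finset ℤ) (n : ℕ)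
    {y : ℕ → H →L[ℂ] H} {x : H →L[ℂ] H} (h : HasSum y x) :
    HasSum (fun i ↦ average α F n (y i)) (average α F n x) := by
  refine HasSum.const_smul _ (hasSum_sum fun k _ ↦ ?_)
  exact h.map (α ^ k) (StarAlgEquiv.isometry (α ^ k)).continuous

theorem isWeaklyWandering_vectorOperator {α : (H →L[ℂ] H) ≃⋆ₐ[ℂ] (H →L[ℂ] H)}
    {U : unitary (H →L[ℂ] H)} (hU : ∀ x, α x = U * x * star (U : H →L[ℂ] H))
    {F : ℕ → Finset ℤ} (hF : IsFolnerSeq F) {f : ℕ → H} (hf : Summable fun n ↦ ‖f n‖ ^ 2)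
    (hfU : ∀ n, f n ∈ (compactPart U)ᗮ) : IsWeaklyWandering α F (vectorOperator f) := by
  refine ⟨isPositive_vectorOperator hf, tendsto_zero_iff_norm_tendsto_zero.1 ?_⟩
  have h (n : ℕ) : average α F n (vectorOperator f) = ∑' i, rankOneMean U (F n) (f i) := by
    rw [← (hasSum_average F n (hasSum_vectorOperator hf)).tsum_eq]
    simp only [average_rankOne hU]
  simp only [h]
  rw [← tsum_zero (β := ℕ) (α := H →L[ℂ] H)]
  -- The `i`-th mean has norm at most `‖f i‖ ^ 2`, uniformly in `n`.
  refine tendsto_tsum_of_dominated_convergence hf (fun i ↦ tendsto_rankOneMean_zero hF (hfU i))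
    (Eventually.of_forall fun n i ↦ norm_finsetMean_le _ (by positivity) fun k ↦ ?_)
  rw [norm_rankOne, norm_unitary_zpow_apply, sq]

theorem exists_isWeaklyWandering [TopologicalSpace.SeparableSpace H]
    {α : (H →L[ℂ] H) ≃⋆ₐ[ℂ] (H →L[ℂ] H)}
    {U : unitary (H →L[ℂ] H)} (hU : ∀ x, α x = U * x * star (U : H →L[ℂ] H))
    {F : ℕ → Finset ℤ} (hF : IsFolnerSeq F) :
    ∃ x : H →L[ℂ] H, IsWeaklyWandering α F x ∧ IsOperatorSupport x (weaklyMixingProj U F) := by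
  -- The ball, unlike the sphere, is nonempty even when the weakly mixing part is zero.
  obtain ⟨f, hf, -, hfE, hsep⟩ := exists_squareSummable_separating (H := H)
    (E := {v | v ∈ weaklyMixingPart U F ∧ ‖v‖ ≤ 1}) ⟨0, by simp⟩ fun v hv ↦ hv.2
  have hfK (n : ℕ) : f n ∈ weaklyMixingPart U F := by
    obtain ⟨c, v, hv, h⟩ := hfE n
    exact h ▸ Submodule.smul_mem _ c hv.1
  refine ⟨vectorOperator f, isWeaklyWandering_vectorOperator hU hF hf fun n ↦ ?_,
    isOperatorSupport_vectorOperator hf _ hfK fun x hx v hv ↦ ?_⟩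
  · rw [← weaklyMixingPart_eq_orthogonal hF U]
    exact hfK n
  · rcases eq_or_ne v 0 with rfl | hv0
    · exact map_zero x
    have h := hsep x hx (((‖v‖ : ℝ) : ℂ)⁻¹ • v)
      ⟨Submodule.smul_mem _ _ hv, (norm_smul_inv_norm (𝕜 := ℂ) hv0).le⟩
    rw [map_smul, smul_eq_zero, inv_eq_zero, Complex.ofReal_eq_zero, norm_eq_zero] at h
    exact h.resolve_left hv0

theorem exists_isNormalState [TopologicalSpace.SeparableSpace H]
    {α : (H →L[ℂ] H) ≃⋆ₐ[ℂ] (H →L[ℂ] H)}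
    {U : unitary (H →L[ℂ] H)} (hU : ∀ x, α x = U * x * star (U : H →L[ℂ] H))
    (hne : compactProj U ≠ 0) :
    ∃ φ : (H →L[ℂ] H) →ₗ[ℂ] ℂ, IsNormalState φ ∧ (∀ x, φ (α x) = φ x) ∧
      IsFunctionalSupport φ (compactProj U) := by
  -- Norm one gives the functional total mass one. All eigenvalues are pooled, so density captures
  -- the whole compact part.
  set E : Set H := {v | ‖v‖ = 1 ∧ ∃ μ : ℂ, (U : H →L[ℂ] H) v = μ • v} with hEdef
  have hnorm {μ : ℂ} {v : H} (hv0 : v ≠ 0) (hv : (U : H →L[ℂ] H) v = μ • v) :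
      ((‖v‖ : ℝ) : ℂ)⁻¹ • v ∈ E :=
    ⟨norm_smul_inv_norm (𝕜 := ℂ) hv0, μ, by rw [map_smul, hv, smul_comm]⟩
  have hvanish (x : H →L[ℂ] H) (hx : ∀ v ∈ E, x v = 0) : ∀ v ∈ compactPart U, x v = 0 := by
    have hle : compactPart U ≤ LinearMap.ker (x : H →ₗ[ℂ] H) := by
      refine Submodule.topologicalClosure_minimal _ (iSup_le fun μ v hv ↦ ?_) x.isClosed_ker
      rw [Module.End.mem_eigenspace_iff] at hv
      rcases eq_or_ne v 0 with rfl | hv0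
      · exact Submodule.zero_mem _
      have h := hx _ (hnorm hv0 hv)
      rw [map_smul, smul_eq_zero, inv_eq_zero, Complex.ofReal_eq_zero, norm_eq_zero] at h
      exact h.resolve_left hv0
    exact fun v hv ↦ hle hv
  have hE : E.Nonempty := by
    by_contra hempty
    rw [Set.not_nonempty_iff_eq_empty] at hempty
    refine hne (ContinuousLinearMap.ext fun η ↦ ?_)
    exact hvanish 1 (by simp [hempty]) _ ((compactPart U).starProjection_apply_mem η)
  obtain ⟨f, hf, hf1, hfE, hsep⟩ := exists_squareSummable_separating hE fun v hv ↦ hv.1.le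
  have hfeig (n : ℕ) : ∃ μ : ℂ, ‖μ‖ = 1 ∧ (U : H →L[ℂ] H) (f n) = μ • f n ∧
      star (U : H →L[ℂ] H) (f n) = μ⁻¹ • f n := by
    obtain ⟨c, v, ⟨hv1, μ, hv⟩, h⟩ := hfE n
    have hv0 : v ≠ 0 := norm_ne_zero_iff.1 (hv1 ▸ one_ne_zero)
    refine ⟨μ, norm_eigenvalue_unitary hv0 hv, ?_, ?_⟩
    · rw [h, map_smul, hv, smul_comm]
    · rw [h, map_smul, inv_unitary_apply_eq_smul hv0 hv, smul_comm]
  have hfK (n : ℕ) : f n ∈ compactPart U := by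
    obtain ⟨μ, -, h, -⟩ := hfeig n
    exact mem_compactPart_of_apply_eq_smul h
  have hsum := hf1 fun v hv ↦ hv.1
  refine ⟨vectorFunctional f hsum.summable, isNormalState_vectorFunctional hsum, fun x ↦ ?_,
    isFunctionalSupport_vectorFunctional _ _ hfK fun x hx ↦ hvanish x (hsep x hx)⟩
  -- Invariance holds term by term: `star U` multiplies `f n` by `μ⁻¹`, and the two phases cancel
  -- because `‖μ‖ = 1`.
  rw [vectorFunctional_apply, vectorFunctional_apply]
  refine tsum_congr fun n ↦ ?_
  obtain ⟨μ, hμ, -, h⟩ := hfeig n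
  have h1 : ⟪f n, (U : H →L[ℂ] H) (x (star (U : H →L[ℂ] H) (f n)))⟫_ℂ =
      ⟪star (U : H →L[ℂ] H) (f n), x (star (U : H →L[ℂ] H) (f n))⟫_ℂ := by
    rw [ContinuousLinearMap.star_eq_adjoint, ContinuousLinearMap.adjoint_inner_left]
  rw [hU]
  refine h1.trans ?_
  rw [h, map_smul, inner_smul_left, inner_smul_right, ← mul_assoc, mul_comm (starRingEnd ℂ _),
    Complex.mul_conj, Complex.normSq_eq_norm_sq, norm_inv, hμ]
  simp

end Main

end NeveuBH

end

theorem mainTheorem10 {H : Type*} [NormedAddCommGroup H] [InnerProductSpace ℂ H]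
    [CompleteSpace H] [TopologicalSpace.SeparableSpace H]
    (α : (H →L[ℂ] H) ≃⋆ₐ[ℂ] (H →L[ℂ] H)) :
    (∃ U : unitary (H →L[ℂ] H), ∀ x, α x = U * x * star (U : H →L[ℂ] H)) ∧
    ∀ U : unitary (H →L[ℂ] H), (∀ x, α x = U * x * star (U : H →L[ℂ] H)) →
    ∀ F : ℕ → Finset ℤ, NeveuBH.IsFolnerSeq F →
      NeveuBH.compactProj U + NeveuBH.weaklyMixingProj U F = 1 ∧
      (NeveuBH.compactProj U ≠ 0 →
        ∃ φ : (H →L[ℂ] H) →ₗ[ℂ] ℂ, NeveuBH.IsNormalState φ ∧ (∀ x, φ (α x) = φ x) ∧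
          NeveuBH.IsFunctionalSupport φ (NeveuBH.compactProj U)) ∧
      ∃ x : H →L[ℂ] H, NeveuBH.IsWeaklyWandering α F x ∧
        NeveuBH.IsOperatorSupport x (NeveuBH.weaklyMixingProj U F) :=
  ⟨NeveuBH.exists_unitary_of_starAlgEquiv α, fun U hU _ hF ↦
    ⟨NeveuBH.compactProj_add_weaklyMixingProj hF U, NeveuBH.exists_isNormalState hU,
      NeveuBH.exists_isWeaklyWandering hU hF⟩⟩
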